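/- Let $\overline z>0$ and let $X$ be the set of cumulative distribution functions (CDFs) of probability measures on $[0,\overline z]$, with the topology of weak convergence of the associated probability measures. For $F,G\in X$ write $F\ge_1 G$ (first-order stochastic dominance) if $F(z)\le G(z)$ for all $z\in[0,\overline z]$. A set $A\subseteq X$ is a \emph{domain} of $\ge_1$ if any two elements $F,G\in A$ satisfy $F\ge_1 G$ or $G\ge_1 F$, and a \emph{maximal domain} if it is a domain that is not strictly contained in another domain. An \emph{arc} in $X$ is a map $\gamma:[0,1]\to X$ that is a homeomorphism onto its image; it joins $\gamma(0)$ and $\gamma(1)$, and it is \emph{$\ge_1$-increasing} if $s\le t$ implies $\gamma(t)\ge_1\gamma(s)$. A nonempty set $A\subseteq X$ is \emph{arc-connected} if any two distinct points of $A$ are joined by an arc whose image lies in $A$. \textbf{Proposition.} The relation $\ge_1$ is arc-connected, that is, every maximal domain of $\ge_1$ is an arc-connected set. Moreover, a set $A\subseteq X$ is a maximal domain of $\ge_1$ if and only if $A=\gamma([0,1])$ for some $\ge_1$-increasing arc $\gamma$ with $\gamma(0)$ the degenerate CDF of the unit mass at $0$ and $\gamma(1)$ the degenerate CDF of the unit mass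 at $\overline z$. -/

import Mathlib

open MeasureTheory Set Filter Topology
open scoped unitInterval

section Preferences

variable {X : Type*}

/-- The relation `r` is complete on `A` (that is, `A` is a domain of `r`). -/
def IsPrefDomain (r : X → X → Prop) (A : Set X) : Prop :=
  ∀ x ∈ A, ∀ y ∈ A, r x y ∨ r y x

/-- A maximal domain: a domain that is not contained in any larger domain. -/
def IsMaximalPrefDomain (r : X → X → Prop) (A : Set X) : Prop :=
  Maximal (IsPrefDomain r) A

variable [TopologicalSpace X]

/-- An arc in `X`: a homeomorphism of `[0,1]` onto a subset of `X`. -/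
def IsArc (γ : I → X) : Prop := IsEmbedding γ

/-- A set is arc-connected if it is nonempty and any two distinct points of it are the endpoints
of an arc lying in the set. -/
def IsArcConnectedSet (A : Set X) : Prop :=
  A.Nonempty ∧ ∀ x ∈ A, ∀ y ∈ A, x ≠ y →
    ∃ γ : I → X, IsArc γ ∧ γ 0 = x ∧ γ 1 = y ∧ range γ ⊆ A

/-- A preference is arc-connected if every maximal domain is arc-connected. -/
def IsArcConnectedPref (r : X → X → Prop) : Prop :=
  ∀ A : Set X, IsMaximalPrefDomain r A → IsArcConnectedSet A

/-- The path `γ` is increasing for the preference `r` (read `r x y` as `x` is at least as good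
as `y`): later points are at least as good as earlier ones. -/
def IsPrefIncreasing (r : X → X → Prop) (γ : I → X) : Prop :=
  ∀ s t : I, s ≤ t → r (γ t) (γ s)

end Preferences

/-- Cumulative distribution functions over the interval `[0, zbar]`, each extended to the real
line by `0` to the left of `0` and by `1` to the right of `zbar`. (A `StieltjesFunction` is a
nondecreasing right-continuous function.) -/
structure IntervalCDF (zbar : ℝ) where
  toStieltjes : StieltjesFunction ℝ
  eq_zero : ∀ z : ℝ, z < 0 → toStieltjes z = 0
  eq_one : ∀ z : ℝ, zbar ≤ z → toStieltjes z = 1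

namespace IntervalCDF

variable {zbar : ℝ}

instance : CoeFun (IntervalCDF zbar) fun _ => ℝ → ℝ := ⟨fun F => F.toStieltjes⟩

theorem measure_compl_Icc (F : IntervalCDF zbar) :
    F.toStieltjes.measure (Icc 0 zbar)ᶜ = 0 := by
  have h0 : Tendsto F.toStieltjes atBot (𝓝 0) :=
    tendsto_const_nhds.congr'
      ((eventually_lt_atBot 0).mono fun z hz => (F.eq_zero z hz).symm)
  have h1 : Tendsto F.toStieltjes atTop (𝓝 1) :=
    tendsto_const_nhds.congr'
      ((eventually_ge_atTop zbar).mono fun z hz => (F.eq_one z hz).symm)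
  have hl : Function.leftLim F.toStieltjes 0 = 0 := by
    refine leftLim_eq_of_tendsto ?_
    refine tendsto_const_nhds.congr' ?_
    filter_upwards [self_mem_nhdsWithin] with z hz using (F.eq_zero z hz).symm
  have hsub : (Icc 0 zbar)ᶜ ⊆ Iio 0 ∪ Ioi zbar := by
    intro z hz
    by_contra h
    simp only [mem_union, mem_Iio, mem_Ioi, not_or, not_lt] at h
    exact hz h
  refine measure_mono_null hsub (measure_union_null ?_ ?_)
  · rw [StieltjesFunction.measure_Iio _ h0, hl]; simp
  · rw [StieltjesFunction.measure_Ioi _ h1, F.eq_one zbar le_rfl]; simp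

theorem measure_Icc (F : IntervalCDF zbar) : F.toStieltjes.measure (Icc 0 zbar) = 1 := by
  have h0 : Tendsto F.toStieltjes atBot (𝓝 0) :=
    tendsto_const_nhds.congr'
      ((eventually_lt_atBot 0).mono fun z hz => (F.eq_zero z hz).symm)
  have h1 : Tendsto F.toStieltjes atTop (𝓝 1) :=
    tendsto_const_nhds.congr'
      ((eventually_ge_atTop zbar).mono fun z hz => (F.eq_one z hz).symm)
  have h := measure_add_measure_compl (μ := F.toStieltjes.measure)
    (measurableSet_Icc (a := (0 : ℝ)) (b := zbar))
  rw [F.measure_compl_Icc, add_zero, StieltjesFunction.measure_univ _ h0 h1] at h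
  simpa using h

/-- The probability measure on `[0, zbar]` associated with a CDF: the Lebesgue–Stieltjes measure
of the CDF, which is concentrated on `[0, zbar]`. -/
noncomputable def toProbabilityMeasure (F : IntervalCDF zbar) :
    ProbabilityMeasure (Icc (0 : ℝ) zbar) :=
  ⟨F.toStieltjes.measure.comap Subtype.val, ⟨by
    rw [comap_subtype_coe_apply measurableSet_Icc, image_univ, Subtype.range_coe]
    exact F.measure_Icc⟩⟩

/-- The topology of weak convergence of the associated probability measures. -/
noncomputable instance : TopologicalSpace (IntervalCDF zbar) :=
  TopologicalSpace.induced toProbabilityMeasure inferInstance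

/-- First-order stochastic dominance: `F ≥₁ G` iff `F z ≤ G z` for all `z ∈ [0, zbar]`. -/
def FOSD (F G : IntervalCDF zbar) : Prop :=
  ∀ z ∈ Icc (0 : ℝ) zbar, F z ≤ G z

/-- The degenerate CDF associated with the point `a` of `[0, zbar]`, that is, the CDF of the
unit mass at `a`. -/
noncomputable def degenerate (a : Icc (0 : ℝ) zbar) : IntervalCDF zbar where
  toStieltjes :=
    { toFun := fun z => if (a : ℝ) ≤ z then 1 else 0
      mono' := by
        intro x y hxy
        by_cases hx : (a : ℝ) ≤ x
        · simp [hx, hx.trans hxy]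
        · by_cases hy : (a : ℝ) ≤ y <;> simp [hx, hy]
      right_continuous' := by
        intro x
        by_cases hx : (a : ℝ) ≤ x
        · refine (continuousWithinAt_const (b := (1 : ℝ))).congr (fun y hy => ?_) ?_
          · exact if_pos (hx.trans hy)
          · exact if_pos hx
        · refine ContinuousAt.continuousWithinAt ?_
          refine (continuousAt_const (y := (0 : ℝ))).congr ?_
          filter_upwards [Iio_mem_nhds (not_le.1 hx)] with y hy
          exact (if_neg (not_le.2 hy)).symm }
  eq_zero := fun _ hz => if_neg (not_le.2 (hz.trans_le a.2.1))
  eq_one := fun _ hz => if_pos (a.2.2.trans hz)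

end IntervalCDF

/-!
Everything rests on the mean `∫ x dF` of the distribution with CDF `F`.

The mean is weakly continuous, and it is strictly monotone for first-order stochastic dominance in
a quantitative form: if `F` dominates `G` and `f` is `L`-Lipschitz, then `L * x + f x` and
`L * x - f x` are monotone in `x`, so that the expectations of `f` under `F` and `G` differ by at
most `L` times the difference of the means (`FOSD.abs_integral_sub_le`). As bounded Lipschitz
functions determine weak convergence, the mean is injective on any domain and its inverse there is
continuous (`eq_of_mean_eq`, `tendsto_of_tendsto_mean`).

On a maximal domain the mean takes every value in `[0, zbar]` (`exists_mean_eq`). Indeed, the space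
of CDFs is compact and dominance is a closed relation, so a maximal domain is compact; a missed
value would leave a gap between two consecutive elements of the domain, and the equal-weight
mixture of these two could be added to it. Hence the inverse of the mean, rescaled to `[0, 1]`, is
an increasing arc whose image is the domain, and any two points of the domain are joined by a part
of this arc.

Conversely, along an increasing arc from the unit mass at `0` to the unit mass at `zbar` the mean
takes every value in `[0, zbar]` by the intermediate value theorem. A distribution comparable with
the whole arc therefore equals the one on the arc that has the same mean.
-/

namespace IntervalCDF

variable {zbar : ℝ}

/-! ### CDFs and their probability measures -/

theorem tendsto_atBot (F : IntervalCDF zbar) : Tendsto F.toStieltjes atBot (𝓝 0) :=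
  tendsto_const_nhds.congr' ((eventually_lt_atBot 0).mono fun z hz => (F.eq_zero z hz).symm)

theorem nonneg (F : IntervalCDF zbar) (z : ℝ) : 0 ≤ F z :=
  F.toStieltjes.mono.le_of_tendsto F.tendsto_atBot z

theorem le_one (F : IntervalCDF zbar) (z : ℝ) : F z ≤ 1 := by
  rw [← F.eq_one _ (le_max_right z zbar)]
  exact F.toStieltjes.mono (le_max_left _ _)

theorem ext_of_forall {F G : IntervalCDF zbar} (h : ∀ z, F z = G z) : F = G := by
  cases F; cases G
  congr
  exact StieltjesFunction.ext h

theorem fosd_iff {F G : IntervalCDF zbar} : FOSD F G ↔ ∀ z, F z ≤ G z := by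
  refine ⟨fun h z => ?_, fun h z _ => h z⟩
  rcases lt_or_ge z 0 with h0 | h0
  · rw [F.eq_zero z h0, G.eq_zero z h0]
  rcases le_or_gt zbar z with h1 | h1
  · rw [F.eq_one z h1, G.eq_one z h1]
  · exact h z ⟨h0, h1.le⟩

theorem fosd_refl (F : IntervalCDF zbar) : FOSD F F := fun _ _ => le_rfl

theorem FOSD.trans {F G H : IntervalCDF zbar} (h₁ : FOSD F G) (h₂ : FOSD G H) : FOSD F H :=
  fun z hz => (h₁ z hz).trans (h₂ z hz)

theorem FOSD.antisymm {F G : IntervalCDF zbar} (h₁ : FOSD F G) (h₂ : FOSD G F) : F = G :=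
  ext_of_forall fun z => le_antisymm (fosd_iff.1 h₁ z) (fosd_iff.1 h₂ z)

theorem toProbabilityMeasure_preimage (F : IntervalCDF zbar) (s : Set ℝ) :
    (F.toProbabilityMeasure : Measure (Icc (0 : ℝ) zbar)) (Subtype.val ⁻¹' s)
      = F.toStieltjes.measure s := by
  change F.toStieltjes.measure.comap Subtype.val _ = _
  rw [comap_subtype_coe_apply measurableSet_Icc, Subtype.image_preimage_coe, inter_comm,
    measure_inter_conull F.measure_compl_Icc]

theorem toProbabilityMeasure_Iic (F : IntervalCDF zbar) (z : ℝ) :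
    (F.toProbabilityMeasure : Measure (Icc (0 : ℝ) zbar)) (Subtype.val ⁻¹' Iic z)
      = ENNReal.ofReal (F z) := by
  rw [F.toProbabilityMeasure_preimage,
    StieltjesFunction.measure_Iic _ F.tendsto_atBot, sub_zero]

theorem toProbabilityMeasure_injective :
    Function.Injective (toProbabilityMeasure (zbar := zbar)) := by
  intro F G h
  refine ext_of_forall fun z => ?_
  have hz := F.toProbabilityMeasure_Iic z
  rw [h, G.toProbabilityMeasure_Iic z] at hz
  exact ((ENNReal.ofReal_eq_ofReal_iff (G.nonneg z) (F.nonneg z)).1 hz).symm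

theorem toProbabilityMeasure_surjective :
    Function.Surjective (toProbabilityMeasure (zbar := zbar)) := by
  intro μ
  have hemb : MeasurableEmbedding (Subtype.val : Icc (0 : ℝ) zbar → ℝ) :=
    MeasurableEmbedding.subtype_coe measurableSet_Icc
  let ν : Measure ℝ := (μ : Measure (Icc (0 : ℝ) zbar)).map Subtype.val
  have : IsProbabilityMeasure ν := Measure.isProbabilityMeasure_map hemb.measurable.aemeasurable
  have hν : ∀ z, ν (Iic z) = (μ : Measure (Icc (0 : ℝ) zbar)) {x | (x : ℝ) ≤ z} :=
    fun z => hemb.map_apply _ _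
  let F : IntervalCDF zbar :=
    { toStieltjes := ProbabilityTheory.cdf ν
      eq_zero := fun z hz => by
        rw [ProbabilityTheory.cdf_eq_real, measureReal_def, hν,
          show {x : Icc (0 : ℝ) zbar | (x : ℝ) ≤ z} = ∅ from
            eq_empty_of_forall_notMem fun x hx => (hz.trans_le x.2.1).not_ge hx]
        simp
      eq_one := fun z hz => by
        rw [ProbabilityTheory.cdf_eq_real, measureReal_def, hν,
          show {x : Icc (0 : ℝ) zbar | (x : ℝ) ≤ z} = univ from
            eq_univ_of_forall fun x => x.2.2.trans hz]
        simp }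
  refine ⟨F, Subtype.ext ?_⟩
  change (ProbabilityTheory.cdf ν).measure.comap Subtype.val = (μ : Measure (Icc (0 : ℝ) zbar))
  rw [ProbabilityTheory.measure_cdf, hemb.comap_map]

theorem isInducing_toProbabilityMeasure :
    IsInducing (toProbabilityMeasure (zbar := zbar)) := ⟨rfl⟩

theorem continuous_toProbabilityMeasure :
    Continuous (toProbabilityMeasure (zbar := zbar)) :=
  isInducing_toProbabilityMeasure.continuous

instance : CompactSpace (IntervalCDF zbar) := by
  refine ⟨isInducing_toProbabilityMeasure.isCompact_iff.2 ?_⟩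
  rw [image_univ, toProbabilityMeasure_surjective.range_eq]
  exact isCompact_univ

/-! ### Dominance is a closed relation -/

/-- `F z ≤ G z` for all `z` amounts to the mass that `F` puts on each open half-line `Iio w`
being at most `G w`, a condition preserved in weak limits by the portmanteau theorem. -/
theorem isClosed_setOf_fosd_right (G : IntervalCDF zbar) : IsClosed {F | FOSD F G} := by
  have key : {F | FOSD F G} = ⋂ w : ℝ, {F : IntervalCDF zbar |
      (F.toProbabilityMeasure : Measure (Icc (0 : ℝ) zbar)) (Subtype.val ⁻¹' Iio w)
        ≤ ENNReal.ofReal (G w)} := by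
    ext F
    simp only [mem_iInter, mem_ofPred_eq]
    rw [fosd_iff]
    constructor
    · intro h w
      calc _ ≤ _ := measure_mono (preimage_mono Iio_subset_Iic_self)
        _ = ENNReal.ofReal (F w) := F.toProbabilityMeasure_Iic w
        _ ≤ _ := ENNReal.ofReal_le_ofReal (h w)
    · intro h z
      have h1 : ∀ w, z < w → F z ≤ G w := by
        intro w hw
        refine (ENNReal.ofReal_le_ofReal_iff (G.nonneg w)).1 ?_
        rw [← F.toProbabilityMeasure_Iic z]
        exact (measure_mono (preimage_mono (Iic_subset_Iio.2 hw))).trans (h w)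
      have h2 : Tendsto G.toStieltjes (𝓝[>] z) (𝓝 (G z)) :=
        (G.toStieltjes.right_continuous z).mono_left (nhdsWithin_mono _ Ioi_subset_Ici_self)
      exact ge_of_tendsto h2 (eventually_mem_nhdsWithin.mono h1)
  rw [key]
  refine isClosed_iInter fun w => ?_
  have hlsc : LowerSemicontinuous fun F : IntervalCDF zbar =>
      (F.toProbabilityMeasure : Measure (Icc (0 : ℝ) zbar)) (Subtype.val ⁻¹' Iio w) :=
    lowerSemicontinuous_iff_le_liminf.2 fun F =>
      ProbabilityMeasure.le_liminf_measure_open_of_tendsto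
        (continuous_toProbabilityMeasure.tendsto F) (isOpen_Iio.preimage continuous_subtype_val)
  exact hlsc.isClosed_preimage _

theorem isClosed_setOf_fosd_left (G : IntervalCDF zbar) : IsClosed {F | FOSD G F} := by
  have key : {F | FOSD G F} = ⋂ z : ℝ, {F : IntervalCDF zbar | ENNReal.ofReal (G z) ≤
      (F.toProbabilityMeasure : Measure (Icc (0 : ℝ) zbar)) (Subtype.val ⁻¹' Iic z)} := by
    ext F
    simp only [mem_iInter, mem_ofPred_eq, toProbabilityMeasure_Iic, fosd_iff,
      ENNReal.ofReal_le_ofReal_iff (F.nonneg _)]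
  rw [key]
  refine isClosed_iInter fun z => ?_
  have husc : UpperSemicontinuous fun F : IntervalCDF zbar =>
      (F.toProbabilityMeasure : Measure (Icc (0 : ℝ) zbar)) (Subtype.val ⁻¹' Iic z) :=
    upperSemicontinuous_iff_limsup_le.2 fun F =>
      ProbabilityMeasure.limsup_measure_closed_le_of_tendsto
        (continuous_toProbabilityMeasure.tendsto F) (isClosed_Iic.preimage continuous_subtype_val)
  exact husc.isClosed_preimage _

/-! ### Dominance and expectations -/

/-- A dominating distribution gives more mass to the sets `{x | t < g x}` of a monotone `g`:
their complements are empty or initial segments. -/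
theorem FOSD.measure_lt_le {F G : IntervalCDF zbar} (h : FOSD F G) {g : Icc (0 : ℝ) zbar → ℝ}
    (hg : Continuous g) (hmono : Monotone g) (t : ℝ) :
    (G.toProbabilityMeasure : Measure (Icc (0 : ℝ) zbar)) {x | t < g x}
      ≤ (F.toProbabilityMeasure : Measure (Icc (0 : ℝ) zbar)) {x | t < g x} := by
  have hcl : IsClosed {x | g x ≤ t} := isClosed_le hg continuous_const
  have hco : {x | t < g x} = {x | g x ≤ t}ᶜ := by ext x; simp
  rw [hco]
  rcases eq_empty_or_nonempty {x | g x ≤ t} with he | hne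
  · simp [he]
  obtain ⟨b, hb, hbmax⟩ := hcl.isCompact.exists_isGreatest hne
  have hs : {x | g x ≤ t} = Subtype.val ⁻¹' Iic (b : ℝ) :=
    Subset.antisymm (fun x hx => hbmax hx) fun x hx => (hmono hx).trans hb
  rw [prob_compl_eq_one_sub hcl.measurableSet, prob_compl_eq_one_sub hcl.measurableSet, hs,
    toProbabilityMeasure_Iic, toProbabilityMeasure_Iic]
  exact tsub_le_tsub_left (ENNReal.ofReal_le_ofReal (fosd_iff.1 h _)) _

theorem integrable_of_continuous (F : IntervalCDF zbar) {g : Icc (0 : ℝ) zbar → ℝ}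
    (hg : Continuous g) :
    Integrable g (F.toProbabilityMeasure : Measure (Icc (0 : ℝ) zbar)) :=
  (BoundedContinuousFunction.mkOfCompact ⟨g, hg⟩).integrable _

theorem FOSD.integral_le_of_nonneg {F G : IntervalCDF zbar} (h : FOSD F G)
    {g : Icc (0 : ℝ) zbar → ℝ} (hg : Continuous g) (hmono : Monotone g) (h0 : 0 ≤ g) :
    ∫ x, g x ∂(G.toProbabilityMeasure : Measure (Icc (0 : ℝ) zbar))
      ≤ ∫ x, g x ∂(F.toProbabilityMeasure : Measure (Icc (0 : ℝ) zbar)) := by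
  have hfin := (F.integrable_of_continuous hg).lintegral_lt_top
  rw [integral_eq_lintegral_of_nonneg_ae (ae_of_all _ h0) hg.aestronglyMeasurable,
    integral_eq_lintegral_of_nonneg_ae (ae_of_all _ h0) hg.aestronglyMeasurable]
  refine ENNReal.toReal_mono hfin.ne ?_
  rw [lintegral_eq_lintegral_meas_lt _ (ae_of_all _ h0) hg.measurable.aemeasurable,
    lintegral_eq_lintegral_meas_lt _ (ae_of_all _ h0) hg.measurable.aemeasurable]
  exact lintegral_mono fun t => h.measure_lt_le hg hmono t

theorem FOSD.integral_le {F G : IntervalCDF zbar} (h : FOSD F G)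
    {g : Icc (0 : ℝ) zbar → ℝ} (hg : Continuous g) (hmono : Monotone g) :
    ∫ x, g x ∂(G.toProbabilityMeasure : Measure (Icc (0 : ℝ) zbar))
      ≤ ∫ x, g x ∂(F.toProbabilityMeasure : Measure (Icc (0 : ℝ) zbar)) := by
  obtain ⟨c, hc⟩ : ∃ c, ∀ x, c ≤ g x := by
    obtain ⟨c, hc⟩ := (isCompact_range hg).bddBelow
    exact ⟨c, fun x => hc (mem_range_self x)⟩
  have := h.integral_le_of_nonneg (g := fun x => g x - c) (hg.sub continuous_const)
    (fun x y hxy => sub_le_sub_right (hmono hxy) c) fun x => sub_nonneg.2 (hc x)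
  rw [integral_sub (F.integrable_of_continuous hg) (integrable_const c),
    integral_sub (G.integrable_of_continuous hg) (integrable_const c)] at this
  simpa using this

/-- The mean of the distribution with CDF `F`. -/
noncomputable def mean (F : IntervalCDF zbar) : ℝ :=
  ∫ x, (x : ℝ) ∂(F.toProbabilityMeasure : Measure (Icc (0 : ℝ) zbar))

theorem continuous_mean : Continuous (mean (zbar := zbar)) :=
  (ProbabilityMeasure.continuous_integral_continuousMap
    (⟨Subtype.val, continuous_subtype_val⟩ : C(Icc (0 : ℝ) zbar, ℝ))).comp
    continuous_toProbabilityMeasure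

theorem FOSD.mean_le {F G : IntervalCDF zbar} (h : FOSD F G) : mean G ≤ mean F :=
  h.integral_le continuous_subtype_val fun _ _ hxy => hxy

/-- Between comparable distributions, expectations of a Lipschitz function `f` differ by at most a
multiple of the difference of the means, since `L * x + f x` and `L * x - f x` are monotone. -/
theorem FOSD.abs_integral_sub_le {F G : IntervalCDF zbar} (h : FOSD F G)
    {f : Icc (0 : ℝ) zbar → ℝ} {L : NNReal} (hf : LipschitzWith L f) :
    |(∫ x, f x ∂(F.toProbabilityMeasure : Measure (Icc (0 : ℝ) zbar)))
      - ∫ x, f x ∂(G.toProbabilityMeasure : Measure (Icc (0 : ℝ) zbar))|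
      ≤ L * (mean F - mean G) := by
  have hL : Continuous fun x : Icc (0 : ℝ) zbar => (L : ℝ) * (x : ℝ) := by fun_prop
  have hd : ∀ x y : Icc (0 : ℝ) zbar, x ≤ y → |f y - f x| ≤ L * ((y : ℝ) - x) := by
    intro x y hxy
    have := hf.dist_le_mul y x
    rwa [Real.dist_eq, Subtype.dist_eq, Real.dist_eq,
      abs_of_nonneg (sub_nonneg.2 (Subtype.coe_le_coe.2 hxy))] at this
  have h1 := h.integral_le (hL.fun_add hf.continuous) fun x y hxy => by
    have := (abs_le.1 (hd x y hxy)).1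
    change (L : ℝ) * x + f x ≤ L * y + f y
    linarith
  have h2 := h.integral_le (hL.fun_sub hf.continuous) fun x y hxy => by
    have := (abs_le.1 (hd x y hxy)).2
    change (L : ℝ) * x - f x ≤ L * y - f y
    linarith
  rw [integral_add (F.integrable_of_continuous hL) (F.integrable_of_continuous hf.continuous),
    integral_add (G.integrable_of_continuous hL) (G.integrable_of_continuous hf.continuous),
    integral_const_mul, integral_const_mul] at h1
  rw [integral_sub (F.integrable_of_continuous hL) (F.integrable_of_continuous hf.continuous),
    integral_sub (G.integrable_of_continuous hL) (G.integrable_of_continuous hf.continuous),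
    integral_const_mul, integral_const_mul] at h2
  simp only [mean]
  rw [abs_le]
  constructor <;> linarith

/-- On a domain, CDFs depend continuously on their means. -/
theorem tendsto_of_tendsto_mean {ι : Type*} {l : Filter ι} [l.IsCountablyGenerated]
    {Φ : ι → IntervalCDF zbar} {F : IntervalCDF zbar} (hcomp : ∀ i, FOSD (Φ i) F ∨ FOSD F (Φ i))
    (hmean : Tendsto (fun i => mean (Φ i)) l (𝓝 (mean F))) : Tendsto Φ l (𝓝 F) := by
  rw [isInducing_toProbabilityMeasure.tendsto_nhds_iff,
    tendsto_iff_forall_lipschitz_integral_tendsto]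
  rintro f - ⟨L, hf⟩
  rw [tendsto_iff_dist_tendsto_zero] at hmean ⊢
  have hlim : Tendsto (fun i => (L : ℝ) * dist (mean (Φ i)) (mean F)) l (𝓝 0) := by
    simpa using hmean.const_mul (L : ℝ)
  refine squeeze_zero (fun _ => dist_nonneg) (fun i => ?_) hlim
  rcases hcomp i with h | h
  · rw [Real.dist_eq (mean _), abs_of_nonneg (sub_nonneg.2 h.mean_le)]
    exact h.abs_integral_sub_le hf
  · rw [dist_comm, dist_comm (mean _), Real.dist_eq (mean _),
      abs_of_nonneg (sub_nonneg.2 h.mean_le)]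
    exact h.abs_integral_sub_le hf

/-- The mean is strictly monotone for dominance. -/
theorem eq_of_mean_eq {F G : IntervalCDF zbar} (h : FOSD F G ∨ FOSD G F)
    (hm : mean F = mean G) : F = G := by
  have ht : Tendsto (fun _ : ℕ => F) atTop (𝓝 G) :=
    tendsto_of_tendsto_mean (fun _ => h) (hm ▸ tendsto_const_nhds)
  exact toProbabilityMeasure_injective
    (tendsto_nhds_unique tendsto_const_nhds ((continuous_toProbabilityMeasure.tendsto G).comp ht))

theorem mean_nonneg (F : IntervalCDF zbar) : 0 ≤ mean F :=
  integral_nonneg fun x => x.2.1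

theorem mean_le_zbar (F : IntervalCDF zbar) : mean F ≤ zbar := by
  refine (integral_mono (F.integrable_of_continuous continuous_subtype_val)
    (integrable_const zbar) fun x => x.2.2).trans ?_
  simp

/-! ### Unit masses and midpoints -/

theorem degenerate_apply (a : Icc (0 : ℝ) zbar) (z : ℝ) :
    degenerate a z = if (a : ℝ) ≤ z then 1 else 0 := rfl

theorem toProbabilityMeasure_degenerate (a : Icc (0 : ℝ) zbar) :
    ((degenerate a).toProbabilityMeasure : Measure (Icc (0 : ℝ) zbar)) = Measure.dirac a := by
  obtain ⟨F, hF⟩ := toProbabilityMeasure_surjective (zbar := zbar) ⟨Measure.dirac a, inferInstance⟩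
  have hFa : degenerate a = F := by
    refine ext_of_forall fun z => ?_
    have hz := F.toProbabilityMeasure_Iic z
    rw [hF, ProbabilityMeasure.coe_mk,
      Measure.dirac_apply' a (measurable_subtype_coe measurableSet_Iic)] at hz
    rw [← ENNReal.ofReal_eq_ofReal_iff ((degenerate a).nonneg z) (F.nonneg z), ← hz,
      degenerate_apply]
    by_cases haz : (a : ℝ) ≤ z <;> simp [indicator, haz]
  rw [hFa, hF, ProbabilityMeasure.coe_mk]

theorem mean_degenerate (a : Icc (0 : ℝ) zbar) : mean (degenerate a) = a := by
  rw [mean, toProbabilityMeasure_degenerate, integral_dirac]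

theorem fosd_degenerate_of_coe_eq_zero (F : IntervalCDF zbar) {a : Icc (0 : ℝ) zbar}
    (ha : (a : ℝ) = 0) : FOSD F (degenerate a) := by
  intro z hz
  rw [degenerate_apply, ha, if_pos hz.1]
  exact F.le_one z

theorem degenerate_fosd_of_coe_eq (F : IntervalCDF zbar) {a : Icc (0 : ℝ) zbar}
    (ha : (a : ℝ) = zbar) : FOSD (degenerate a) F := by
  intro z hz
  rw [degenerate_apply, ha]
  split_ifs with h
  · rw [F.eq_one z h]
  · exact F.nonneg z

/-- The equal-weight mixture of two distributions. -/
noncomputable def midpoint (F G : IntervalCDF zbar) : IntervalCDF zbar where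
  toStieltjes := (1 / 2 : NNReal) • (F.toStieltjes + G.toStieltjes)
  eq_zero z hz := by
    change ((1 / 2 : NNReal) : ℝ) * (F z + G z) = 0
    simp [F.eq_zero z hz, G.eq_zero z hz]
  eq_one z hz := by
    change ((1 / 2 : NNReal) : ℝ) * (F z + G z) = 1
    rw [F.eq_one z hz, G.eq_one z hz]
    norm_num

theorem midpoint_apply (F G : IntervalCDF zbar) (z : ℝ) : midpoint F G z = (F z + G z) / 2 := by
  change ((1 / 2 : NNReal) : ℝ) * (F z + G z) = _
  push_cast
  ring

theorem FOSD.fosd_midpoint {F G : IntervalCDF zbar} (h : FOSD F G) : FOSD F (midpoint F G) := by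
  intro z hz
  have := h z hz
  rw [midpoint_apply]
  linarith

theorem FOSD.midpoint_fosd {F G : IntervalCDF zbar} (h : FOSD F G) : FOSD (midpoint F G) G := by
  intro z hz
  have := h z hz
  rw [midpoint_apply]
  linarith

theorem eq_of_midpoint_eq_left {F G : IntervalCDF zbar} (h : midpoint F G = F) : F = G := by
  refine ext_of_forall fun z => ?_
  have := midpoint_apply F G z
  rw [h] at this
  linarith

theorem eq_of_midpoint_eq_right {F G : IntervalCDF zbar} (h : midpoint F G = G) : F = G := by
  refine ext_of_forall fun z => ?_
  have := midpoint_apply F G z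
  rw [h] at this
  linarith

/-! ### Maximal domains -/

theorem mem_of_forall_comparable {A : Set (IntervalCDF zbar)} (hA : IsMaximalPrefDomain FOSD A)
    {F : IntervalCDF zbar} (hF : ∀ G ∈ A, FOSD F G ∨ FOSD G F) : F ∈ A := by
  refine hA.mem_of_prop_insert ?_
  rintro x (rfl | hx) y (rfl | hy)
  · exact Or.inl (fosd_refl _)
  · exact hF y hy
  · exact (hF x hx).symm
  · exact hA.prop x hx y hy

theorem fosd_of_mean_le {A : Set (IntervalCDF zbar)} (hA : IsPrefDomain FOSD A)
    {F G : IntervalCDF zbar} (hF : F ∈ A) (hG : G ∈ A) (h : mean G ≤ mean F) : FOSD F G := by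
  rcases hA F hF G hG with h' | h'
  · exact h'
  · rw [eq_of_mean_eq (Or.inr h') (le_antisymm h'.mean_le h)]
    exact fosd_refl _

theorem isClosed_of_isMaximalPrefDomain {A : Set (IntervalCDF zbar)}
    (hA : IsMaximalPrefDomain FOSD A) : IsClosed A := by
  have : A = ⋂ G ∈ A, ({F | FOSD F G} ∪ {F | FOSD G F}) := by
    refine Subset.antisymm (fun F hF => ?_) fun F hF => ?_
    · exact mem_iInter₂.2 fun G hG => hA.prop F hF G hG
    · exact mem_of_forall_comparable hA fun G hG => mem_iInter₂.1 hF G hG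
  rw [this]
  exact isClosed_biInter fun G _ =>
    (isClosed_setOf_fosd_right G).union (isClosed_setOf_fosd_left G)

theorem degenerate_mem {A : Set (IntervalCDF zbar)} (hA : IsMaximalPrefDomain FOSD A)
    {a : Icc (0 : ℝ) zbar} (ha : (a : ℝ) = 0 ∨ (a : ℝ) = zbar) : degenerate a ∈ A :=
  mem_of_forall_comparable hA fun G _ => ha.elim
    (fun h => Or.inr (fosd_degenerate_of_coe_eq_zero G h))
    fun h => Or.inl (degenerate_fosd_of_coe_eq G h)

/-- The means of the elements of a maximal domain fill `[0, zbar]`. A value `c` that is missed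
would leave a gap in the domain between a greatest element `H` of mean below `c` and a least
element `K` of mean above `c`; the midpoint of `H` and `K` is comparable with the whole domain
and lies in the gap. -/
theorem exists_mean_eq {A : Set (IntervalCDF zbar)} (hA : IsMaximalPrefDomain FOSD A) {c : ℝ}
    (hc : c ∈ Icc 0 zbar) : ∃ F ∈ A, mean F = c := by
  by_contra! hne
  have hz : 0 ≤ zbar := hc.1.trans hc.2
  have hcpt : IsCompact A := (isClosed_of_isMaximalPrefDomain hA).isCompact
  obtain ⟨H, ⟨hHA, hHc⟩, hHmax⟩ := (hcpt.inter_right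
    (isClosed_le continuous_mean (continuous_const (y := c)))).exists_isMaxOn
    ⟨degenerate ⟨0, left_mem_Icc.2 hz⟩, degenerate_mem hA (Or.inl rfl),
      (mean_degenerate _).trans_le hc.1⟩ continuous_mean.continuousOn
  obtain ⟨K, ⟨hKA, hKc⟩, hKmin⟩ := (hcpt.inter_right
    (isClosed_le (continuous_const (y := c)) continuous_mean)).exists_isMinOn
    ⟨degenerate ⟨zbar, right_mem_Icc.2 hz⟩, degenerate_mem hA (Or.inr rfl),
      hc.2.trans (mean_degenerate ⟨zbar, right_mem_Icc.2 hz⟩).ge⟩ continuous_mean.continuousOn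
  have hHc' : mean H ≤ c := hHc
  have hKc' : c ≤ mean K := hKc
  have hKH : FOSD K H := fosd_of_mean_le hA.prop hKA hHA (hHc'.trans hKc')
  have hKH_ne : K ≠ H := by
    rintro rfl
    exact hne K hKA (le_antisymm hHc' hKc')
  have hmem : midpoint K H ∈ A := by
    refine mem_of_forall_comparable hA fun G hG => ?_
    rcases le_total (mean G) c with hGc | hGc
    · exact Or.inl (hKH.midpoint_fosd.trans (fosd_of_mean_le hA.prop hHA hG (hHmax ⟨hG, hGc⟩)))
    · exact Or.inr ((fosd_of_mean_le hA.prop hG hKA (hKmin ⟨hG, hGc⟩)).trans hKH.fosd_midpoint)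
  rcases le_total (mean (midpoint K H)) c with hmc | hmc
  · exact hKH_ne (eq_of_midpoint_eq_right
      (hKH.midpoint_fosd.antisymm (fosd_of_mean_le hA.prop hHA hmem (hHmax ⟨hmem, hmc⟩))))
  · exact hKH_ne (eq_of_midpoint_eq_left
      ((fosd_of_mean_le hA.prop hmem hKA (hKmin ⟨hmem, hmc⟩)).antisymm hKH.fosd_midpoint))

/-- A maximal domain is parametrized by its normalized mean: this is an increasing arc joining the
two extreme unit masses. -/
theorem exists_arc_of_isMaximalPrefDomain (hz : 0 < zbar) {A : Set (IntervalCDF zbar)}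
    (hA : IsMaximalPrefDomain FOSD A) :
    ∃ γ : I → IntervalCDF zbar, IsArc γ ∧ IsPrefIncreasing FOSD γ ∧
      γ 0 = degenerate ⟨0, left_mem_Icc.2 hz.le⟩ ∧
      γ 1 = degenerate ⟨zbar, right_mem_Icc.2 hz.le⟩ ∧ range γ = A := by
  have hex : ∀ t : I, ∃ F ∈ A, mean F = t * zbar := fun t =>
    exists_mean_eq hA ⟨mul_nonneg t.2.1 hz.le, mul_le_of_le_one_left hz.le t.2.2⟩
  choose γ hγA hγm using hex
  have huniq : ∀ F ∈ A, ∀ t : I, mean F = t * zbar → γ t = F := fun F hF t h =>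
    eq_of_mean_eq (hA.prop _ (hγA t) F hF) ((hγm t).trans h.symm)
  have hcont : Continuous γ := continuous_iff_continuousAt.2 fun t => by
    refine tendsto_of_tendsto_mean (fun s => hA.prop _ (hγA s) _ (hγA t)) ?_
    simp only [hγm]
    exact Continuous.tendsto (by fun_prop) t
  have hinv : Function.LeftInverse (fun F => projIcc (0 : ℝ) 1 zero_le_one (mean F / zbar)) γ := by
    intro t
    simp only [hγm, mul_div_cancel_right₀ _ hz.ne', projIcc_val]
  refine ⟨γ, hinv.isEmbedding ?_ hcont, fun s t hst => ?_, ?_, ?_, ?_⟩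
  · exact continuous_projIcc.comp (continuous_mean.div_const zbar)
  · refine fosd_of_mean_le hA.prop (hγA t) (hγA s) ?_
    rw [hγm, hγm]
    exact mul_le_mul_of_nonneg_right hst hz.le
  · exact huniq _ (degenerate_mem hA (Or.inl rfl)) _ (by simp [mean_degenerate])
  · exact huniq _ (degenerate_mem hA (Or.inr rfl)) _ (by simp [mean_degenerate])
  · refine Subset.antisymm (range_subset_iff.2 hγA) fun F hF => ?_
    refine ⟨⟨mean F / zbar, div_nonneg F.mean_nonneg hz.le,
      (div_le_one hz).2 F.mean_le_zbar⟩, huniq F hF _ ?_⟩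
    exact (div_mul_cancel₀ _ hz.ne').symm

/-- The means along a path between the extreme unit masses take every value in `[0, zbar]`, so a
distribution comparable with the whole path coincides with the one of equal mean on the path. -/
theorem isMaximalPrefDomain_range (hz : 0 < zbar) {γ : I → IntervalCDF zbar}
    (hcont : Continuous γ) (hinc : IsPrefIncreasing FOSD γ)
    (h0 : γ 0 = degenerate ⟨0, left_mem_Icc.2 hz.le⟩)
    (h1 : γ 1 = degenerate ⟨zbar, right_mem_Icc.2 hz.le⟩) :
    IsMaximalPrefDomain FOSD (range γ) := by
  refine ⟨?_, fun B hB hsub F hF => ?_⟩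
  · rintro _ ⟨s, rfl⟩ _ ⟨t, rfl⟩
    exact (le_total t s).imp (hinc t s) (hinc s t)
  · have hivt := intermediate_value_univ (0 : I) 1 (continuous_mean.comp hcont)
    simp only [Function.comp_apply, h0, h1, mean_degenerate] at hivt
    obtain ⟨t, ht⟩ := hivt ⟨F.mean_nonneg, F.mean_le_zbar⟩
    exact ⟨t, eq_of_mean_eq (hB _ (hsub (mem_range_self t)) F hF) ht⟩

end IntervalCDF

/-! ### Arc-connectedness -/

/-- Two points on an arc are joined by the part of the arc between them. -/
theorem IsArc.isArcConnectedSet_range {X : Type*} [TopologicalSpace X] {γ : I → X}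
    (hγ : IsArc γ) : IsArcConnectedSet (range γ) := by
  refine ⟨range_nonempty γ, ?_⟩
  rintro _ ⟨s, rfl⟩ _ ⟨t, rfl⟩ hne
  have hst : (t : ℝ) - s ≠ 0 := fun h => hne (by rw [Subtype.ext (sub_eq_zero.1 h)])
  let φ : I → I := fun u => ⟨(1 - u) * s + u * t, (convex_Icc (0 : ℝ) 1) s.2 t.2
    (sub_nonneg.2 u.2.2) u.2.1 (sub_add_cancel _ _)⟩
  have hφ : Continuous φ := Continuous.subtype_mk (by fun_prop) _
  have hinj : Function.Injective φ := by
    intro u v huv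
    have h : (1 - (u : ℝ)) * s + u * t = (1 - (v : ℝ)) * s + v * t := congrArg Subtype.val huv
    exact Subtype.ext (mul_right_cancel₀ hst (by linarith))
  refine ⟨γ ∘ φ, IsEmbedding.comp hγ (hφ.isClosedEmbedding hinj).isEmbedding, ?_, ?_,
    range_comp_subset_range φ γ⟩
  · exact congrArg γ (Subtype.ext (by simp [φ]))
  · exact congrArg γ (Subtype.ext (by simp [φ]))

theorem mainTheorem5 (zbar : ℝ) (hz : 0 < zbar) :
    IsArcConnectedPref (IntervalCDF.FOSD (zbar := zbar)) ∧
    ∀ A : Set (IntervalCDF zbar),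
      IsMaximalPrefDomain IntervalCDF.FOSD A ↔
        ∃ γ : unitInterval → IntervalCDF zbar,
          IsArc γ ∧ IsPrefIncreasing IntervalCDF.FOSD γ ∧
          γ 0 = IntervalCDF.degenerate ⟨0, Set.left_mem_Icc.2 hz.le⟩ ∧
          γ 1 = IntervalCDF.degenerate ⟨zbar, Set.right_mem_Icc.2 hz.le⟩ ∧
          Set.range γ = A := by
  refine ⟨fun A hA => ?_, fun A => ⟨IntervalCDF.exists_arc_of_isMaximalPrefDomain hz, ?_⟩⟩
  · obtain ⟨γ, hγ, -, -, -, rfl⟩ := IntervalCDF.exists_arc_of_isMaximalPrefDomain hz hA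
    exact hγ.isArcConnectedSet_range
  · rintro ⟨γ, hγ, hinc, h0, h1, rfl⟩
    exact IntervalCDF.isMaximalPrefDomain_range hz (IsEmbedding.continuous hγ) hinc h0 h1
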